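/- \textbf{Theorem.} Let $n\ge 1$ and let $(G(n),u)$ be a compact matrix quantum group: $C(G(n))$ is a unital $C^*$-algebra and $u=(u_{i,j})\in M_n(C(G(n)))$ is such that (1) $C(G(n))$ is the universal $C^*$-algebra generated by the $u_{i,j}$ subject to some set of relations (non-commutative $*$-polynomials in the $u_{i,j}$); (2) $u$ and $u^\top=(u_{j,i})$ are invertible; (3) there is a $*$-homomorphism $\Delta\colon C(G(n))\to C(G(n))\otimes_{\min}C(G(n))$ with $\Delta(u_{i,j})=\sum_k u_{i,k}\otimes u_{k,j}$. Assume, as usual, that $u$ and $u^\top$ are unitary. Put $u^{\circ}=u$ and $u^{\bullet}=\bar u=(u_{i,j}^*)$, and for a word $w$ of length $k\ge 0$ in the colours $\circ,\bullet$ let $u^{\otimes w}\in M_{n^k}(C(G(n)))$ be the corresponding Kronecker product of the matrices $u^\circ,u^\bullet$ (with $u^{\otimes\varnothing}=1$). For words $w_k,w_l$ of lengths $k,l$ let $$\mathrm{FundRep}_{G(n)}(w_k,w_l)=\{\phi\colon(\mathbb C^n)^{\otimes k}\to(\mathbb C^n)^{\otimes l}\text{ linear}\;:\;\phi\,u^{\otimes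 w_k}=u^{\otimes w_l}\,\phi\}.$$ Then $\mathrm{FundRep}_{G(n)}$ is a two-coloured representation category; that is, every $\mathrm{FundRep}_{G(n)}(w_k,w_l)$ is a linear subspace of the space of linear maps $(\mathbb C^n)^{\otimes k}\to(\mathbb C^n)^{\otimes l}$, and \begin{enumerate} \item if $\phi_1\in\mathrm{FundRep}_{G(n)}(w_k,w_l)$ and $\phi_2\in\mathrm{FundRep}_{G(n)}(w_q,w_m)$, then $\phi_1\otimes\phi_2\in\mathrm{FundRep}_{G(n)}(w_k\cdot w_q,\,w_l\cdot w_m)$, where $\cdot$ is concatenation of words; \item if $\phi_1\in\mathrm{FundRep}_{G(n)}(w_k,w_l)$ and $\phi_2\in\mathrm{FundRep}_{G(n)}(w_l,w_m)$, then $\phi_2\circ\phi_1\in\mathrm{FundRep}_{G(n)}(w_k,w_m)$; \item if $\phi\in\mathrm{FundRep}_{G(n)}(w_k,w_l)$, then $\phi^*\in\mathrm{FundRep}_{G(n)}(w_l,w_k)$; \item for every word $w$ of length $k$, the identity $1_n^{\otimes k}$ lies in $\mathrm{FundRep}_{G(n)}(w,w)$; \item the map $R\colon 1\mapsto\sum_{i=1}^n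 e_i\otimes e_i$ lies in both $\mathrm{FundRep}_{G(n)}(\varnothing,\circ\bullet)$ and $\mathrm{FundRep}_{G(n)}(\varnothing,\bullet\circ)$. \end{enumerate} -/

import Mathlib

open scoped TensorProduct

universe u

namespace QuantumGroup

/-! ### Universal C*-algebras given by generators and relations -/

/-- The free `*`-algebra `P(E)` on symbols `x_i`, `i : ι`: complex linear combinations of
words in the symbols `x_i` (encoded `Sum.inl i`) and `x_i^*` (encoded `Sum.inr i`). -/
abbrev FreeStarAlgebra (ι : Type*) : Type _ := MonoidAlgebra ℂ (FreeMonoid (ι ⊕ ι))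

/-- The involution on words: reverse the word and exchange `x_i` and `x_i^*`. -/
def wordStar {ι : Type*} (w : FreeMonoid (ι ⊕ ι)) : FreeMonoid (ι ⊕ ι) :=
  FreeMonoid.ofList ((w.toList.map Sum.swap).reverse)

/-- The involution on `P(E)`, the antilinear extension of the involution on words. -/
noncomputable def polyStar {ι : Type*} (p : FreeStarAlgebra ι) : FreeStarAlgebra ι :=
  p.coeff.sum fun w c => MonoidAlgebra.single (wordStar w) (star c)

/-- Evaluation of a non-commutative `*`-polynomial at elements `x_i` of a `*`-algebra. -/
noncomputable def polyEval {ι : Type*} {A : Type*} [CStarAlgebra A] (x : ι → A) :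
    FreeStarAlgebra ι →ₐ[ℂ] A :=
  MonoidAlgebra.lift ℂ A (FreeMonoid (ι ⊕ ι))
    (FreeMonoid.lift (Sum.elim x fun i => star (x i)))

/-- A C*-seminorm on the universal `*`-algebra `A(E ∣ R) = P(E) / I(R)`, given as a C*-seminorm
on `P(E)` that vanishes on the relations `R` (hence on the `*`-ideal `I(R)` they generate). -/
structure IsCStarSeminorm {ι : Type*} (R : Set (FreeStarAlgebra ι))
    (γ : FreeStarAlgebra ι → ℝ) : Prop where
  nonneg : ∀ p, 0 ≤ γ p
  smul : ∀ (c : ℂ) p, γ (c • p) = ‖c‖ * γ p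
  add_le : ∀ p q, γ (p + q) ≤ γ p + γ q
  mul_le : ∀ p q, γ (p * q) ≤ γ p * γ q
  star_mul_self : ∀ p, γ (polyStar p * p) = γ p ^ 2
  rel : ∀ p ∈ R, γ p = 0

/-- `A`, with the elements `x_i`, is the universal C*-algebra `C*(E ∣ R)`: it is the
completion of (the separated quotient of) `A(E ∣ R)` for the supremum of all C*-seminorms
on `A(E ∣ R)`, the generators being mapped to the `x_i`. -/
structure IsUniversalCStarAlgebra {ι : Type*} {A : Type*} [CStarAlgebra A]
    (R : Set (FreeStarAlgebra ι)) (x : ι → A) : Prop where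
  denseRange : DenseRange (polyEval x)
  isLUB_norm : ∀ p : FreeStarAlgebra ι,
    IsLUB {r : ℝ | ∃ γ, IsCStarSeminorm R γ ∧ r = γ p} ‖polyEval x p‖

/-! ### The minimal tensor product -/

/-- The Hilbert space tensor product: the completion of the algebraic tensor product. -/
def HilbertTensor (H K : Type*) [NormedAddCommGroup H] [InnerProductSpace ℂ H]
    [NormedAddCommGroup K] [InnerProductSpace ℂ K] : Type _ :=
  UniformSpace.Completion (H ⊗[ℂ] K)

section HilbertTensor

variable {H K : Type*} [NormedAddCommGroup H] [InnerProductSpace ℂ H]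
  [NormedAddCommGroup K] [InnerProductSpace ℂ K]

noncomputable instance : NormedAddCommGroup (HilbertTensor H K) :=
  inferInstanceAs (NormedAddCommGroup (UniformSpace.Completion (H ⊗[ℂ] K)))

noncomputable instance : InnerProductSpace ℂ (HilbertTensor H K) :=
  inferInstanceAs (InnerProductSpace ℂ (UniformSpace.Completion (H ⊗[ℂ] K)))

instance : CompleteSpace (HilbertTensor H K) :=
  inferInstanceAs (CompleteSpace (UniformSpace.Completion (H ⊗[ℂ] K)))

/-- The bounded operator `S ⊗ T` on the Hilbert space tensor product. -/
noncomputable def opTensor (S : H →L[ℂ] H) (T : K →L[ℂ] K) :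
    HilbertTensor H K →L[ℂ] HilbertTensor H K :=
  (TensorProduct.mapL S T).completion

end HilbertTensor

/-- The minimal (spatial) tensor product `A ⊗_min B`, for faithful `*`-representations `π` of
`A` on `H` and `ρ` of `B` on `K`: the norm closure, in the bounded operators on the Hilbert
space tensor product of `H` and `K`, of the `*`-algebra generated by the `π a ⊗ ρ b`. Up to
isomorphism it does not depend on the faithful representations. -/
noncomputable def minTensor {A B : Type*} [CStarAlgebra A] [CStarAlgebra B] {H K : Type*}
    [NormedAddCommGroup H] [InnerProductSpace ℂ H] [CompleteSpace H]
    [NormedAddCommGroup K] [InnerProductSpace ℂ K] [CompleteSpace K]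
    (π : A →⋆ₐ[ℂ] (H →L[ℂ] H)) (ρ : B →⋆ₐ[ℂ] (K →L[ℂ] K)) :
    StarSubalgebra ℂ (HilbertTensor H K →L[ℂ] HilbertTensor H K) :=
  (StarAlgebra.adjoin ℂ {T | ∃ a b, T = opTensor (π a) (ρ b)}).topologicalClosure

/-! ### Compact matrix quantum groups -/

/-- The pair `(A, u)` is a compact matrix quantum group, with `A = C(G(n))`. -/
structure IsCompactMatrixQuantumGroup {A : Type u} [CStarAlgebra A] {n : ℕ}
    (u : Matrix (Fin n) (Fin n) A) : Prop where
  pos : 0 < n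
  universal : ∃ R : Set (FreeStarAlgebra (Fin n × Fin n)),
    IsUniversalCStarAlgebra R fun ij => u ij.1 ij.2
  isUnit : IsUnit u
  isUnit_transpose : IsUnit u.transpose
  comul : ∃ (H : Type u) (_ : NormedAddCommGroup H) (_ : InnerProductSpace ℂ H)
    (_ : CompleteSpace H) (π : A →⋆ₐ[ℂ] (H →L[ℂ] H)), Function.Injective π ∧
      ∃ Δ : A →⋆ₐ[ℂ] minTensor π π, ∀ i j,
        (Δ (u i j) : HilbertTensor H H →L[ℂ] HilbertTensor H H)
          = ∑ k, opTensor (π (u i k)) (π (u k j))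

/-! ### Intertwiners -/

/-- The matrix of a linear map in the standard bases, with its scalar entries viewed in `A`. -/
noncomputable def scalarMatrix (A : Type*) [CStarAlgebra A] {α β : Type*} [Fintype α]
    [DecidableEq α] [Fintype β] (φ : EuclideanSpace ℂ α →ₗ[ℂ] EuclideanSpace ℂ β) :
    Matrix β α A :=
  (LinearMap.toMatrix (EuclideanSpace.basisFun α ℂ).toBasis
    (EuclideanSpace.basisFun β ℂ).toBasis φ).map (algebraMap ℂ A)

/-- `Hom(v, w)`: the linear maps `φ` with `φ v = w φ`, as an identity of matrices over `A`. -/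
noncomputable def Hom {A : Type*} [CStarAlgebra A] {α β : Type*} [Fintype α] [DecidableEq α]
    [Fintype β] [DecidableEq β] (v : Matrix α α A) (w : Matrix β β A) :
    Submodule ℂ (EuclideanSpace ℂ α →ₗ[ℂ] EuclideanSpace ℂ β) where
  carrier := {φ | scalarMatrix A φ * v = w * scalarMatrix A φ}
  zero_mem' := by
    have h : scalarMatrix A (0 : EuclideanSpace ℂ α →ₗ[ℂ] EuclideanSpace ℂ β) = 0 := by
      ext i j; simp [scalarMatrix]
    simp [h]
  add_mem' := by
    intro φ ψ hφ hψ
    have h : scalarMatrix A (φ + ψ) = scalarMatrix A φ + scalarMatrix A ψ := by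
      ext i j; simp [scalarMatrix]
    change scalarMatrix A φ * v = w * scalarMatrix A φ at hφ
    change scalarMatrix A ψ * v = w * scalarMatrix A ψ at hψ
    change scalarMatrix A (φ + ψ) * v = w * scalarMatrix A (φ + ψ)
    rw [h, Matrix.add_mul, Matrix.mul_add, hφ, hψ]
  smul_mem' := by
    intro c φ hφ
    have h : scalarMatrix A (c • φ) = c • scalarMatrix A φ := by
      ext i j; simp [scalarMatrix, Algebra.smul_def]
    change scalarMatrix A φ * v = w * scalarMatrix A φ at hφ
    change scalarMatrix A (c • φ) * v = w * scalarMatrix A (c • φ)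
    rw [h, Matrix.smul_mul, Matrix.mul_smul, hφ]

/-! ### Words and tensor powers of the fundamental representation -/

/-- The two colours `∘` and `•`. -/
inductive Colour : Type
  | white
  | black

/-- Words of length `k` in the two colours; concatenation is `Fin.append`. -/
abbrev Word (k : ℕ) : Type := Fin k → Colour

/-- `(ℂⁿ)^{⊗ k}`, with its standard orthonormal basis `e_I = e_{I 0} ⊗ ⋯ ⊗ e_{I (k-1)}`. -/
abbrev TensorSpace (n k : ℕ) : Type := EuclideanSpace ℂ (Fin k → Fin n)

/-- The standard basis `e_I` of `(ℂⁿ)^{⊗ k}`. -/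
noncomputable def stdBasis (n k : ℕ) : Module.Basis (Fin k → Fin n) ℂ (TensorSpace n k) :=
  (EuclideanSpace.basisFun (Fin k → Fin n) ℂ).toBasis

/-- The identification `(ℂⁿ)^{⊗ k} ⊗ (ℂⁿ)^{⊗ l} = (ℂⁿ)^{⊗ (k + l)}`, `e_I ⊗ e_J = e_{I · J}`. -/
noncomputable def concatEquiv (n k l : ℕ) :
    TensorSpace n k ⊗[ℂ] TensorSpace n l ≃ₗ[ℂ] TensorSpace n (k + l) :=
  ((stdBasis n k).tensorProduct (stdBasis n l)).equiv (stdBasis n (k + l)) (Fin.appendEquiv k l)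

/-- The tensor product `φ ⊗ ψ` of linear maps between tensor powers of `ℂⁿ`. -/
noncomputable def tensorMap {n k l q m : ℕ} (φ : TensorSpace n k →ₗ[ℂ] TensorSpace n l)
    (ψ : TensorSpace n q →ₗ[ℂ] TensorSpace n m) :
    TensorSpace n (k + q) →ₗ[ℂ] TensorSpace n (l + m) :=
  (concatEquiv n l m).toLinearMap ∘ₗ TensorProduct.map φ ψ ∘ₗ
    (concatEquiv n k q).symm.toLinearMap

/-- The duality map `R : 1 ↦ ∑ i, e_i ⊗ e_i` from `(ℂⁿ)^{⊗ 0} = ℂ` to `(ℂⁿ)^{⊗ 2}`. -/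
noncomputable def dualityMap (n : ℕ) : TensorSpace n 0 →ₗ[ℂ] TensorSpace n 2 :=
  (stdBasis n 0).constr ℂ fun _ => ∑ i : Fin n, stdBasis n 2 ![i, i]

/-- `u^∘ = u` and `u^• = ū`, the entrywise adjoint. -/
def colourRep {A : Type*} [CStarAlgebra A] {n : ℕ} (u : Matrix (Fin n) (Fin n) A) :
    Colour → Matrix (Fin n) (Fin n) A
  | Colour.white => u
  | Colour.black => u.map star

/-- `u^{⊗ w}`: the Kronecker product, in this order, of the matrices `u^{w 0}, …, u^{w (k-1)}`. -/
def wordRep {A : Type*} [CStarAlgebra A] {n : ℕ} (u : Matrix (Fin n) (Fin n) A) {k : ℕ}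
    (w : Word k) : Matrix (Fin k → Fin n) (Fin k → Fin n) A :=
  Matrix.of fun I J => (List.ofFn fun i => colourRep u (w i) (I i) (J i)).prod

/-- `FundRep_{G(n)}(w_k, w_l) = Hom(u^{⊗ w_k}, u^{⊗ w_l})`. -/
noncomputable def FundRep {A : Type*} [CStarAlgebra A] {n : ℕ} (u : Matrix (Fin n) (Fin n) A)
    (k l : ℕ) (v : Word k) (w : Word l) :
    Submodule ℂ (TensorSpace n k →ₗ[ℂ] TensorSpace n l) :=
  Hom (wordRep u v) (wordRep u w)

/-- A two-coloured representation category: a collection of subspaces `C(v, w)` of the linear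
maps `(ℂⁿ)^{⊗ k} → (ℂⁿ)^{⊗ l}`, for all words `v` and `w` of lengths `k` and `l`. -/
structure IsTwoColouredRepCategory {n : ℕ}
    (C : ∀ k l : ℕ, Word k → Word l → Submodule ℂ (TensorSpace n k →ₗ[ℂ] TensorSpace n l)) :
    Prop where
  tensor_mem : ∀ {k l q m : ℕ} {wk : Word k} {wl : Word l} {wq : Word q} {wm : Word m}
    {φ₁ : TensorSpace n k →ₗ[ℂ] TensorSpace n l} {φ₂ : TensorSpace n q →ₗ[ℂ] TensorSpace n m},
    φ₁ ∈ C k l wk wl → φ₂ ∈ C q m wq wm →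
      tensorMap φ₁ φ₂ ∈ C (k + q) (l + m) (Fin.append wk wq) (Fin.append wl wm)
  comp_mem : ∀ {k l m : ℕ} {wk : Word k} {wl : Word l} {wm : Word m}
    {φ₁ : TensorSpace n k →ₗ[ℂ] TensorSpace n l} {φ₂ : TensorSpace n l →ₗ[ℂ] TensorSpace n m},
    φ₁ ∈ C k l wk wl → φ₂ ∈ C l m wl wm → φ₂ ∘ₗ φ₁ ∈ C k m wk wm
  adjoint_mem : ∀ {k l : ℕ} {wk : Word k} {wl : Word l}
    {φ : TensorSpace n k →ₗ[ℂ] TensorSpace n l},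
    φ ∈ C k l wk wl → LinearMap.adjoint φ ∈ C l k wl wk
  id_mem : ∀ {k : ℕ} (w : Word k), LinearMap.id ∈ C k k w w
  duality_mem_white_black : dualityMap n ∈ C 0 2 ![] ![Colour.white, Colour.black]
  duality_mem_black_white : dualityMap n ∈ C 0 2 ![] ![Colour.black, Colour.white]

end QuantumGroup

namespace QuantumGroup

/-! ### Intertwiners between arbitrary square matrices over `A`. -/

section Intertwiners

variable {A : Type*} [CStarAlgebra A] {α β γ : Type*} [Fintype α] [DecidableEq α]
  [Fintype β]

/-! Everything is matrix algebra over `A`. Identities and composition are formal. Tensor products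
work because `wordRep` is multiplicative under concatenation and scalar entries are central in `A`,
so the two intertwining relations can be interleaved (`tensorMap_mem_FundRep`). Adjoints work
because every `wordRep u w` is unitary (`wordRep_mem_unitary`), which needs both `u` and its
transpose to be unitary; taking adjoints of the relation then reverses it (`adjoint_mem_Hom`). For
the duality map, the two memberships amount to `u u* = 1` and `ū uᵀ = 1` (`dualityMap_mem_FundRep`).
-/

theorem mem_Hom [DecidableEq β] {v : Matrix α α A} {w : Matrix β β A}
    {φ : EuclideanSpace ℂ α →ₗ[ℂ] EuclideanSpace ℂ β} :
    φ ∈ Hom v w ↔ scalarMatrix A φ * v = w * scalarMatrix A φ := Iff.rfl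

theorem scalarMatrix_apply (φ : EuclideanSpace ℂ α →ₗ[ℂ] EuclideanSpace ℂ β) (b : β) (a : α) :
    scalarMatrix A φ b a = algebraMap ℂ A (φ ((EuclideanSpace.basisFun α ℂ).toBasis a) b) := by
  simp [scalarMatrix, LinearMap.toMatrix_apply]

theorem scalarMatrix_id :
    scalarMatrix A (LinearMap.id : EuclideanSpace ℂ α →ₗ[ℂ] EuclideanSpace ℂ α) = 1 := by
  rw [scalarMatrix, LinearMap.toMatrix_id, Matrix.map_one _ (map_zero _) (map_one _)]

theorem scalarMatrix_comp [DecidableEq β] [Fintype γ] (φ : EuclideanSpace ℂ α →ₗ[ℂ] EuclideanSpace ℂ β)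
    (ψ : EuclideanSpace ℂ β →ₗ[ℂ] EuclideanSpace ℂ γ) :
    scalarMatrix A (ψ ∘ₗ φ) = scalarMatrix A ψ * scalarMatrix A φ := by
  rw [scalarMatrix, LinearMap.toMatrix_comp _ (EuclideanSpace.basisFun β ℂ).toBasis,
    Matrix.map_mul]
  rfl

/-- The standard bases are orthonormal and `algebraMap ℂ A` preserves the star. -/
theorem scalarMatrix_adjoint [DecidableEq β] (φ : EuclideanSpace ℂ α →ₗ[ℂ] EuclideanSpace ℂ β) :
    scalarMatrix A (LinearMap.adjoint φ) = (scalarMatrix A φ).conjTranspose := by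
  rw [scalarMatrix, LinearMap.toMatrix_adjoint]
  ext i j
  exact algebraMap_star_comm _

theorem comp_mem_Hom [DecidableEq β] [Fintype γ] [DecidableEq γ] {v : Matrix α α A} {w : Matrix β β A} {x : Matrix γ γ A}
    {φ : EuclideanSpace ℂ α →ₗ[ℂ] EuclideanSpace ℂ β}
    {ψ : EuclideanSpace ℂ β →ₗ[ℂ] EuclideanSpace ℂ γ}
    (hφ : φ ∈ Hom v w) (hψ : ψ ∈ Hom w x) : ψ ∘ₗ φ ∈ Hom v x := by
  rw [mem_Hom] at *
  rw [scalarMatrix_comp, Matrix.mul_assoc, hφ, ← Matrix.mul_assoc, hψ, Matrix.mul_assoc]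

/-- The adjoint of `φ v = w φ` is `v* φ* = φ* w*`; multiply by `v` on the left and `w` on the right,
using `v v* = 1` and `w* w = 1`. -/
theorem adjoint_mem_Hom [DecidableEq β] {v : Matrix α α A} {w : Matrix β β A}
    (hv : v ∈ unitary (Matrix α α A)) (hw : w ∈ unitary (Matrix β β A))
    {φ : EuclideanSpace ℂ α →ₗ[ℂ] EuclideanSpace ℂ β} (hφ : φ ∈ Hom v w) :
    LinearMap.adjoint φ ∈ Hom w v := by
  rw [mem_Hom] at *
  rw [scalarMatrix_adjoint]
  have h := congrArg Matrix.conjTranspose hφ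
  rw [Matrix.conjTranspose_mul, Matrix.conjTranspose_mul] at h
  have hv' : v * v.conjTranspose = 1 := hv.2
  have hw' : w.conjTranspose * w = 1 := hw.1
  calc (scalarMatrix A φ).conjTranspose * w
      = v * (v.conjTranspose * (scalarMatrix A φ).conjTranspose) * w := by
        rw [← Matrix.mul_assoc v, hv', Matrix.one_mul]
    _ = v * (scalarMatrix A φ).conjTranspose := by
        rw [h, Matrix.mul_assoc, Matrix.mul_assoc, hw', Matrix.mul_one]

end Intertwiners

/-! ### Kronecker products along words, and the operations on their intertwiners. -/

section Words

variable {A : Type*} [CStarAlgebra A] {n : ℕ} (u : Matrix (Fin n) (Fin n) A)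

theorem wordRep_cons {k : ℕ} (w : Word (k + 1)) (i j : Fin n) (I J : Fin k → Fin n) :
    wordRep u w (Fin.cons i I) (Fin.cons j J) =
      colourRep u (w 0) i j * wordRep u (Fin.tail w) I J := by
  simp [wordRep, List.ofFn_succ, Fin.tail]

theorem wordRep_append {k l : ℕ} (v : Word k) (w : Word l) (I I' : Fin k → Fin n)
    (J J' : Fin l → Fin n) :
    wordRep u (Fin.append v w) (Fin.append I J) (Fin.append I' J') =
      wordRep u v I I' * wordRep u w J J' := by
  simp [wordRep, List.ofFn_add]

theorem sum_fin_cons {k : ℕ} (f : (Fin (k + 1) → Fin n) → A) :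
    ∑ K, f K = ∑ i, ∑ I, f (Fin.cons i I) := by
  rw [← (Fin.consEquiv fun _ => Fin n).sum_comp, Fintype.sum_prod_type]
  rfl

theorem colourRep_mem_unitary {u : Matrix (Fin n) (Fin n) A}
    (hu : u ∈ unitary (Matrix (Fin n) (Fin n) A))
    (hut : u.transpose ∈ unitary (Matrix (Fin n) (Fin n) A)) (c : Colour) :
    colourRep u c ∈ unitary (Matrix (Fin n) (Fin n) A) := by
  cases c with
  | white => exact hu
  -- The entrywise adjoint of `u` is the adjoint matrix of `uᵀ`.
  | black => exact Unitary.star_mem hut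

/-- Induction on the word, splitting off its first letter. As `A` is noncommutative, the order of
summation matters: the factors that meet in the middle of the product must be summed first. -/
theorem wordRep_mem_unitary {u : Matrix (Fin n) (Fin n) A}
    (hu : u ∈ unitary (Matrix (Fin n) (Fin n) A))
    (hut : u.transpose ∈ unitary (Matrix (Fin n) (Fin n) A)) {k : ℕ} (w : Word k) :
    wordRep u w ∈ unitary (Matrix (Fin k → Fin n) (Fin k → Fin n) A) := by
  induction k with
  | zero =>
    have h : wordRep u w = 1 := by
      ext I J
      rw [Subsingleton.elim I J, Matrix.one_apply_eq]
      simp [wordRep]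
    rw [h]
    exact one_mem _
  | succ k ih =>
    obtain ⟨h₁, h₂⟩ := ih (Fin.tail w)
    obtain ⟨c₁, c₂⟩ := colourRep_mem_unitary hu hut (w 0)
    refine ⟨?_, ?_⟩
    · ext I J
      obtain ⟨i, I, rfl⟩ : ∃ i I', I = Fin.cons i I' := ⟨_, _, (Fin.cons_self_tail I).symm⟩
      obtain ⟨j, J, rfl⟩ : ∃ j J', J = Fin.cons j J' := ⟨_, _, (Fin.cons_self_tail J).symm⟩
      have h₁' := congrFun₂ h₁ I J
      have c₁' := congrFun₂ c₁ i j
      simp only [Matrix.mul_apply, Matrix.star_apply] at h₁' c₁' ⊢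
      -- The star reverses products, so here the two first-letter factors are adjacent and their
      -- index is summed first.
      rw [sum_fin_cons, Finset.sum_comm]
      have (K : Fin k → Fin n) : ∑ x, star (wordRep u w (Fin.cons x K) (Fin.cons i I)) *
          wordRep u w (Fin.cons x K) (Fin.cons j J) =
          star (wordRep u (Fin.tail w) K I) * (1 : Matrix (Fin n) (Fin n) A) i j *
            wordRep u (Fin.tail w) K J := by
        rw [← c₁', Finset.mul_sum, Finset.sum_mul]
        simp only [wordRep_cons, star_mul, mul_assoc]
      simp only [this]
      by_cases hij : i = j
      · subst hij
        simp [h₁', Matrix.one_apply, Fin.cons_inj]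
      · simp [hij, Fin.cons_inj]
    · ext I J
      obtain ⟨i, I, rfl⟩ : ∃ i I', I = Fin.cons i I' := ⟨_, _, (Fin.cons_self_tail I).symm⟩
      obtain ⟨j, J, rfl⟩ : ∃ j J', J = Fin.cons j J' := ⟨_, _, (Fin.cons_self_tail J).symm⟩
      have h₂' := congrFun₂ h₂ I J
      have c₂' := congrFun₂ c₂ i j
      simp only [Matrix.mul_apply, Matrix.star_apply] at h₂' c₂' ⊢
      -- Now the two tail factors are adjacent, so the inner sum is over the tail index.
      rw [sum_fin_cons]
      have (x : Fin n) : ∑ K, wordRep u w (Fin.cons i I) (Fin.cons x K) *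
          star (wordRep u w (Fin.cons j J) (Fin.cons x K)) =
          colourRep u (w 0) i x * (1 : Matrix (Fin k → Fin n) (Fin k → Fin n) A) I J *
            star (colourRep u (w 0) j x) := by
        rw [← h₂', Finset.mul_sum, Finset.sum_mul]
        simp only [wordRep_cons, star_mul, mul_assoc]
      simp only [this]
      by_cases hIJ : I = J
      · subst hIJ
        simp [c₂', Matrix.one_apply, Fin.cons_inj]
      · simp [hIJ, Fin.cons_inj]

theorem scalarMatrix_tensorMap {k l q m : ℕ} (φ : TensorSpace n k →ₗ[ℂ] TensorSpace n l)
    (ψ : TensorSpace n q →ₗ[ℂ] TensorSpace n m) (I : Fin l → Fin n) (J : Fin m → Fin n)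
    (K : Fin k → Fin n) (L : Fin q → Fin n) :
    scalarMatrix A (tensorMap φ ψ) (Fin.append I J) (Fin.append K L) =
      scalarMatrix A φ I K * scalarMatrix A ψ J L := by
  have h₁ : (concatEquiv n k q).symm (stdBasis n (k + q) (Fin.append K L)) =
      stdBasis n k K ⊗ₜ stdBasis n q L := by
    rw [LinearEquiv.symm_apply_eq, ← Module.Basis.tensorProduct_apply, concatEquiv,
      Module.Basis.equiv_apply]
    rfl
  have h₂ (x : TensorSpace n l) (y : TensorSpace n m) :
      concatEquiv n l m (x ⊗ₜ y) (Fin.append I J) = x I * y J := by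
    have h : (stdBasis n (l + m)).repr (concatEquiv n l m (x ⊗ₜ y)) (Fin.append I J) =
        (stdBasis n l).repr x I * (stdBasis n m).repr y J := by
      have h' : (Fin.appendEquiv l m).symm (Fin.append I J) = (I, J) :=
        (Fin.appendEquiv l m).symm_apply_apply (I, J)
      simp [concatEquiv, Module.Basis.equiv, ← Finsupp.linearCombination_mapDomain,
        Finsupp.mapDomain_equiv_apply, h', mul_comm]
    simpa [stdBasis] using h
  rw [scalarMatrix_apply, scalarMatrix_apply, scalarMatrix_apply, ← map_mul, ← h₂]
  congr 1
  change concatEquiv n l m (TensorProduct.map φ ψ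
    ((concatEquiv n k q).symm (stdBasis n (k + q) (Fin.append K L)))) (Fin.append I J) = _
  rw [h₁, TensorProduct.map_tmul]
  rfl

theorem sum_fin_append {k l : ℕ} (f : (Fin (k + l) → Fin n) → A) :
    ∑ K, f K = ∑ I, ∑ J, f (Fin.append I J) := by
  rw [← (Fin.appendEquiv k l).sum_comp, Fintype.sum_prod_type]
  rfl

theorem tensorMap_mem_FundRep {k l q m : ℕ} {v : Word k} {w : Word l} {v' : Word q} {w' : Word m}
    {φ : TensorSpace n k →ₗ[ℂ] TensorSpace n l} {ψ : TensorSpace n q →ₗ[ℂ] TensorSpace n m}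
    (hφ : φ ∈ FundRep u k l v w) (hψ : ψ ∈ FundRep u q m v' w') :
    tensorMap φ ψ ∈ FundRep u (k + q) (l + m) (Fin.append v v') (Fin.append w w') := by
  rw [FundRep, mem_Hom] at *
  ext IJ KL
  obtain ⟨⟨I, J⟩, rfl⟩ := (Fin.appendEquiv l m).surjective IJ
  obtain ⟨⟨K, L⟩, rfl⟩ := (Fin.appendEquiv k q).surjective KL
  have hφ' := congrFun₂ hφ I K
  have hψ' := congrFun₂ hψ J L
  simp only [Matrix.mul_apply] at hφ' hψ' ⊢
  change ∑ x, scalarMatrix A (tensorMap φ ψ) (Fin.append I J) x *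
      wordRep u (Fin.append v v') x (Fin.append K L) =
    ∑ x, wordRep u (Fin.append w w') (Fin.append I J) x *
      scalarMatrix A (tensorMap φ ψ) x (Fin.append K L)
  simp only [sum_fin_append, wordRep_append, scalarMatrix_tensorMap]
  -- Middle-four interchange, valid because `c` is a scalar and hence central.
  have h (a b c d : A) (z : ℂ) (hc : c = algebraMap ℂ A z) :
      a * c * (b * d) = (a * b) * (c * d) := by
    rw [mul_assoc, ← mul_assoc c, hc, Algebra.commutes z b]
    simp only [mul_assoc]
  have e₁ (x : Fin k → Fin n) (y : Fin q → Fin n) :=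
    h (scalarMatrix A φ I x) (wordRep u v x K) _ (wordRep u v' y L) _
      (scalarMatrix_apply (A := A) ψ J y)
  have e₂ (x : Fin l → Fin n) (y : Fin m → Fin n) :=
    h (wordRep u w I x) (wordRep u w' J y) _ (scalarMatrix A ψ y L) _
      (scalarMatrix_apply (A := A) φ x K)
  simp only [e₁, ← e₂, ← Finset.mul_sum, ← Finset.sum_mul, hφ', hψ']

/-- The coefficients of the duality map form the identity matrix, and the empty word gives the
matrix `1`, so the intertwining relation is exactly `h` read entrywise. -/
theorem dualityMap_mem_FundRep {u : Matrix (Fin n) (Fin n) A} (w : Word 2)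
    (h : colourRep u (w 0) * (colourRep u (w 1)).transpose = 1) :
    dualityMap n ∈ FundRep u 0 2 ![] w := by
  have hR (I : Fin 2 → Fin n) (J : Fin 0 → Fin n) : scalarMatrix A (dualityMap n) I J =
      (1 : Matrix (Fin n) (Fin n) A) (I 0) (I 1) := by
    rw [scalarMatrix_apply]
    have h₀ : dualityMap n (stdBasis n 0 J) = ∑ i : Fin n, stdBasis n 2 ![i, i] :=
      Module.Basis.constr_basis _ _ _ _
    change algebraMap ℂ A (dualityMap n (stdBasis n 0 J) I) = _
    rw [h₀]
    have h₁ (x : Fin n) : I = ![x, x] ↔ x = I 0 ∧ x = I 1 := by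
      simp [funext_iff, eq_comm]
    simp [stdBasis, Pi.single_apply, h₁, ite_and, Matrix.one_apply]
  rw [FundRep, mem_Hom]
  ext I J
  have h' := congrFun₂ h (I 0) (I 1)
  simp only [Matrix.mul_apply, Matrix.transpose_apply] at h'
  simp only [Matrix.mul_apply, hR]
  rw [← (finTwoArrowEquiv (Fin n)).symm.sum_comp (fun x => wordRep u w I x * _),
    Fintype.sum_prod_type]
  simp [wordRep, Matrix.one_apply, ← h']

end Words

end QuantumGroup

theorem mainTheorem3 {A : Type u} [CStarAlgebra A] {n : ℕ} (u : Matrix (Fin n) (Fin n) A)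
    (hG : QuantumGroup.IsCompactMatrixQuantumGroup u)
    (hu : u ∈ unitary (Matrix (Fin n) (Fin n) A))
    (hut : u.transpose ∈ unitary (Matrix (Fin n) (Fin n) A)) :
    QuantumGroup.IsTwoColouredRepCategory (QuantumGroup.FundRep u) where
  tensor_mem := QuantumGroup.tensorMap_mem_FundRep u
  comp_mem := QuantumGroup.comp_mem_Hom
  adjoint_mem := QuantumGroup.adjoint_mem_Hom (QuantumGroup.wordRep_mem_unitary hu hut _)
    (QuantumGroup.wordRep_mem_unitary hu hut _)
  id_mem w := by
    rw [QuantumGroup.FundRep, QuantumGroup.mem_Hom, QuantumGroup.scalarMatrix_id,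
      Matrix.one_mul, Matrix.mul_one]
  duality_mem_white_black := QuantumGroup.dualityMap_mem_FundRep _ hu.2
  duality_mem_black_white := QuantumGroup.dualityMap_mem_FundRep _ hut.1
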